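/- Let $N\ge 2$, $d\ge 1$, $[N]=\{1,\dots,N\}$, $\mathcal X=[N]^d$. A model consists of random objects $\xi_x$ ($x\in\mathcal X$) with values in a measurable space $\mathsf Y$ and a function $F:\mathcal X\times\mathsf Y\to\mathbb R$ (measurable in its second argument); its objective is $f(x)=\mathbb E[F(x,\xi_x)]$. A function $f:\mathcal X\to\mathbb R$ is $L^\natural$-convex if $f(x)+f(y)\ge f(\lceil (x+y)/2\rceil)+f(\lfloor (x+y)/2\rfloor)$ for all $x,y\in\mathcal X$ (componentwise rounding). For $\sigma>0$ let $\mathcal{MC}$ be the class of all models whose objective is $L^\natural$-convex and for which every $F(x,\xi_x)$ is sub-Gaussian with parameter $\sigma^2$, i.e. $\mathbb E\, e^{t(F(x,\xi_x)-f(x))}\le e^{\sigma^2t^2/2}$ for all $t\in\mathbb R$; let $\mathcal{MC}_{\mathrm G}\subset\mathcal{MC}$ be the subclass in which $F(x,\xi_x)\sim\mathcal N(f(x),\sigma^2)$ for every $x\in\mathcal X$. A (zeroth-order) simulation algorithm sequentially chooses decisions $x\in\mathcal X$, each time observing only a fresh independent copy of $F(x,\xi_x)$. Its sampling rule, its stopping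 rule and its recommendation rule depend measurably on the past observations and possibly on an independent internal random seed. Let $\tau$ be the number of simulations run when it stops. For $\epsilon,\delta>0$ and a class $\mathcal M$ of models, the algorithm is an $((\epsilon,\delta)\text{-PGS},\mathcal M)$-algorithm if on every model in $\mathcal M$ it stops almost surely and the decision $\hat x$ that it returns satisfies $f(\hat x)-\min_{\mathcal X} f\le\epsilon$ with probability at least $1-\delta$. The expected simulation cost is $$T(\epsilon,\delta,\mathcal M)=\inf_{\mathbf A}\ \sup_{M\in\mathcal M}\ \mathbb E_{M}[\tau]\in[0,\infty],$$ where the infimum is over all $((\epsilon,\delta)\text{-PGS},\mathcal M)$-algorithms $\mathbf A$. **Theorem.** There are universal constants $c>0$ and $\delta_0>0$ such that for all $N\ge2$, $d\ge1$, $\sigma>0$, $\epsilon>0$ and $0<\delta\le\delta_0$, $$T(\epsilon,\delta,\mathcal{MC}_{\mathrm G})\ \ge\ c\,\frac{d\,\sigma^2}{\epsilon^2}\log\frac1\delta \qquad\text{and}\qquad T(\epsilon,\delta,\mathcal{MC})\ \ge\ c\,\frac{d\,\sigma^2}{\epsilon^2}\log\frac1\delta .$$ -/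

import Mathlib

open MeasureTheory ProbabilityTheory
open scoped NNReal ENNReal

/-! ### Decision set and `L♮`-convexity -/

/-- The decision set `[N]^d`, where `[N] = {1, …, N}`. -/
abbrev DecisionSet (N d : ℕ) : Type := Fin d → Set.Icc (1 : ℤ) (N : ℤ)

/-- The componentwise rounded-up midpoint `⌈(x + y) / 2⌉`. -/
def ceilMidpoint {N d : ℕ} (x y : DecisionSet N d) : DecisionSet N d := fun i =>
  ⟨⌈(((x i : ℤ) : ℚ) + ((y i : ℤ) : ℚ)) / 2⌉, by
    have hx1 : (1 : ℚ) ≤ ((x i : ℤ) : ℚ) := by exact_mod_cast (x i).2.1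
    have hy1 : (1 : ℚ) ≤ ((y i : ℤ) : ℚ) := by exact_mod_cast (y i).2.1
    have hx2 : ((x i : ℤ) : ℚ) ≤ ((N : ℤ) : ℚ) := by exact_mod_cast (x i).2.2
    have hy2 : ((y i : ℤ) : ℚ) ≤ ((N : ℤ) : ℚ) := by exact_mod_cast (y i).2.2
    constructor
    · rw [← Int.sub_one_lt_iff, Int.lt_ceil]
      push_cast
      linarith
    · rw [Int.ceil_le]
      linarith⟩

/-- The componentwise rounded-down midpoint `⌊(x + y) / 2⌋`. -/
def floorMidpoint {N d : ℕ} (x y : DecisionSet N d) : DecisionSet N d := fun i =>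
  ⟨⌊(((x i : ℤ) : ℚ) + ((y i : ℤ) : ℚ)) / 2⌋, by
    have hx1 : (1 : ℚ) ≤ ((x i : ℤ) : ℚ) := by exact_mod_cast (x i).2.1
    have hy1 : (1 : ℚ) ≤ ((y i : ℤ) : ℚ) := by exact_mod_cast (y i).2.1
    have hx2 : ((x i : ℤ) : ℚ) ≤ ((N : ℤ) : ℚ) := by exact_mod_cast (x i).2.2
    have hy2 : ((y i : ℤ) : ℚ) ≤ ((N : ℤ) : ℚ) := by exact_mod_cast (y i).2.2
    constructor
    · rw [Int.le_floor]
      push_cast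
      linarith
    · rw [← Int.lt_add_one_iff, Int.floor_lt]
      push_cast at *
      linarith⟩

/-- `L♮`-convexity on `[N]^d`: discrete midpoint convexity. -/
def LNaturalConvex {N d : ℕ} (f : DecisionSet N d → ℝ) : Prop :=
  ∀ x y : DecisionSet N d,
    f (ceilMidpoint x y) + f (floorMidpoint x y) ≤ f x + f y

/-! ### Simulation models -/

/-- A stochastic simulation model with decision set `X`: for every `x` a random object `ξ_x`
with values in `Y`, known here through its law, and the performance function `F(x, ξ_x)`. -/
structure SimModel (X : Type) where
  /-- the space of randomness -/
  Y : Type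
  [measurableSpaceY : MeasurableSpace Y]
  /-- the law of `ξ_x` -/
  xiLaw : X → Measure Y
  [isProbXi : ∀ x, IsProbabilityMeasure (xiLaw x)]
  /-- the performance function -/
  F : X → Y → ℝ
  measurable_F : ∀ x, Measurable (F x)

attribute [instance] SimModel.measurableSpaceY SimModel.isProbXi

namespace SimModel

variable {X : Type}

/-- The objective function `f(x) = 𝔼[F(x, ξ_x)]`. -/
noncomputable def objective (M : SimModel X) (x : X) : ℝ := ∫ y, M.F x y ∂(M.xiLaw x)

/-- The distribution on `ℝ` of one simulation output `F(x, ξ_x)`. -/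
noncomputable def outputLaw (M : SimModel X) (x : X) : Measure ℝ := (M.xiLaw x).map (M.F x)

instance isProbOutputLaw (M : SimModel X) (x : X) : IsProbabilityMeasure (M.outputLaw x) :=
  Measure.isProbabilityMeasure_map (M.measurable_F x).aemeasurable

end SimModel

/-- The class `MC` of convex models on `[N]^d`: the objective is `L♮`-convex and every output
`F(x, ξ_x)` is sub-Gaussian with parameter `σ²`, that is,
`𝔼[exp (t (F(x, ξ_x) - f(x)))] ≤ exp (σ² t² / 2)` for all real `t`. -/
def convexModels (N d : ℕ) (σ : ℝ≥0) : Set (SimModel (DecisionSet N d)) :=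
  {M | LNaturalConvex M.objective ∧
    ∀ x, HasSubgaussianMGF (fun y => M.F x y - M.objective x) (σ ^ 2) (M.xiLaw x)}

/-- The Gaussian convex models on `[N]^d`: the objective is `L♮`-convex and every output
`F(x, ξ_x)` is normal with mean `f(x)` and variance `σ²`. -/
def gaussianConvexModels (N d : ℕ) (σ : ℝ≥0) : Set (SimModel (DecisionSet N d)) :=
  {M | LNaturalConvex M.objective ∧
    ∀ x, M.outputLaw x = gaussianReal (M.objective x) (σ ^ 2)}

/-! ### Zeroth-order simulation algorithms -/

/-- The record of the first `n` simulations: the simulated decisions and their outputs. -/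
abbrev History (X : Type) (n : ℕ) : Type := Fin n → X × ℝ

/-- A sequential (possibly randomized) simulation algorithm. All its rules may depend on the
history so far and on an internal random seed that is independent of the simulations. -/
structure SimAlgorithm (X : Type) [MeasurableSpace X] where
  /-- the space of the internal randomness; a one-point space for a deterministic algorithm -/
  Seed : Type
  [measurableSpaceSeed : MeasurableSpace Seed]
  seedLaw : Measure Seed
  [isProbSeed : IsProbabilityMeasure seedLaw]
  /-- the sampling rule: the decision to simulate next, after `n` simulations -/
  sampling : ∀ n, Seed × History X n → X
  measurable_sampling : ∀ n, Measurable (sampling n)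
  /-- the stopping rule: the situations in which to stop after `n` simulations -/
  stopping : ∀ n, Set (Seed × History X n)
  measurableSet_stopping : ∀ n, MeasurableSet (stopping n)
  /-- the recommendation rule: the decision to return when stopped after `n` simulations -/
  recommend : ∀ n, Seed × History X n → X
  measurable_recommend : ∀ n, Measurable (recommend n)

attribute [instance] SimAlgorithm.measurableSpaceSeed SimAlgorithm.isProbSeed

namespace SimAlgorithm

variable {X : Type} [MeasurableSpace X]

/-- Sample space of a run: the seed, and a table `v` whose entry `v (n, x)` is the output that
the simulation number `n` (counted from `0`) produces if it simulates the decision `x`. -/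
abbrev RunSpace (A : SimAlgorithm X) : Type := A.Seed × (ℕ × X → ℝ)

/-- Law of a run on the model `M`: the seed and all table entries are independent, and
the entry `(n, x)` is a fresh copy of `F(x, ξ_x)`. -/
noncomputable def runLaw (A : SimAlgorithm X) (M : SimModel X) : Measure A.RunSpace :=
  A.seedLaw.prod (Measure.infinitePi fun p : ℕ × X => M.outputLaw p.2)

/-- The history after `n` simulations (of the sampling rule run without stopping); only the
table entries that belong to the simulated decisions are revealed. -/
def history (A : SimAlgorithm X) (ω : A.RunSpace) : ∀ n, History X n
  | 0 => Fin.elim0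
  | n + 1 =>
    let h := A.history ω n
    let x := A.sampling n (ω.1, h)
    Fin.snoc (α := fun _ => X × ℝ) h (x, ω.2 (n, x))

/-- The stopping time: the first `n` at which the stopping rule says stop, `⊤` if it never does.
It is the number of simulations that are run. -/
noncomputable def stopTime (A : SimAlgorithm X) (ω : A.RunSpace) : ℕ∞ :=
  ⨅ (n : ℕ) (_ : (ω.1, A.history ω n) ∈ A.stopping n), (n : ℕ∞)

/-- The probability that, on the model `M`, the algorithm stops and returns a decision in `S`. -/
noncomputable def returnProb (A : SimAlgorithm X) (M : SimModel X) (S : Set X) : ℝ≥0∞ :=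
  A.runLaw M {ω | ∃ n : ℕ, A.stopTime ω = n ∧ A.recommend n (ω.1, A.history ω n) ∈ S}

/-- The expected number of simulations `𝔼[τ]` on the model `M`. -/
noncomputable def expectedCost (A : SimAlgorithm X) (M : SimModel X) : ℝ≥0∞ :=
  ∫⁻ ω, (A.stopTime ω : ℝ≥0∞) ∂(A.runLaw M)

end SimAlgorithm

/-! ### Optimality guarantees and the expected simulation cost -/

/-- An optimality guarantee: for a model and the distribution of a returned decision (as a
function of sets of decisions), whether the guarantee is met. -/
abbrev Guarantee (X : Type) : Type 1 := SimModel X → (Set X → ℝ≥0∞) → Prop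

/-- The `(ε, δ)`-PGS guarantee: with probability at least `1 - δ`, the returned decision has
objective value at most `ε` larger than the optimal value. -/
def PGS {X : Type} (ε δ : ℝ) : Guarantee X := fun M P =>
  ENNReal.ofReal (1 - δ) ≤ P {x | ∀ y, M.objective x - M.objective y ≤ ε}

/-- `A` is an `(O, 𝓜)`-algorithm: on every model in `𝓜` it stops almost surely, and the returned
decision meets the guarantee `O`. -/
def IsAlgorithmFor {X : Type} [MeasurableSpace X] (O : Guarantee X) (𝓜 : Set (SimModel X))
    (A : SimAlgorithm X) : Prop :=
  ∀ M ∈ 𝓜, (∀ᵐ ω ∂(A.runLaw M), A.stopTime ω < ⊤) ∧ O M (A.returnProb M)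

/-- The expected simulation cost `T(O, 𝓜) = inf_A sup_M 𝔼[τ]`, the infimum over all
`(O, 𝓜)`-algorithms `A` and the supremum over all models `M` in `𝓜`. -/
noncomputable def simulationCost {X : Type} [MeasurableSpace X] (O : Guarantee X)
    (𝓜 : Set (SimModel X)) : ℝ≥0∞ :=
  ⨅ (A : SimAlgorithm X) (_ : IsAlgorithmFor O 𝓜 A), ⨆ M ∈ 𝓜, A.expectedCost M

/-! ### Measurability of runs -/

/-! The cube contains a best-arm problem with `d + 1` arms, the chain of points `C k = (2, …, 2, 1,
…, 1)` for `0 ≤ k ≤ d`. The integer function `chainPenalty` vanishes on the chain and gains at least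
`1` in every nontrivial midpoint inequality (`chainPenalty_midpoint`), so a large multiple of it
absorbs any bounded perturbation (`LNaturalConvex.chainPenalty_add`). Values on the chain can
therefore be lowered independently of each other.

In the base Gaussian model `C 0` has value `-2ε`, the other chain points have value `0`, and only `C
0` is `ε`-optimal. Lowering one `C k` to `-4ε` makes `C k` the only `ε`-optimal point. A correct
algorithm must tell the two models apart, which takes order `(σ² / ε²) log (1/δ)` expected
simulations of `C k` on the base model (`le_lintegral_visits`). The base model is the same for all
`k`, and each simulation visits one point, so the `d` bounds add up.

The bound for one arm compares the base model `M` with `M'` (mean shifted at one point) and with its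
reflection `M''` (opposite shift). The product of the two likelihood ratios is `exp (-κ · visits)`,
free of noise. By Markov's inequality the ratio of `M''` is rarely large; if visits are also few,
the ratio of `M'` cannot be small, and a recommendation typical for `M` would be too likely on `M'`.
-/

theorem measurable_fin_snoc {α β : Type*} [MeasurableSpace α] [MeasurableSpace β] {n : ℕ}
    {f : α → Fin n → β} {g : α → β} (hf : Measurable f) (hg : Measurable g) :
    Measurable fun a => (Fin.snoc (α := fun _ => β) (f a) (g a) : Fin (n + 1) → β) := by
  refine measurable_pi_iff.2 fun i => ?_
  refine Fin.lastCases ?_ (fun j => ?_) i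
  · simpa using hg
  · simpa [Function.comp_def] using (measurable_pi_apply j).comp hf

namespace SimAlgorithm

variable {X : Type} [MeasurableSpace X] (A : SimAlgorithm X)

/-- The observations after `n` simulations: the seed and the history. -/
def observation (n : ℕ) (ω : A.RunSpace) : A.Seed × History X n := (ω.1, A.history ω n)

theorem measurable_history [Countable X] [MeasurableSingletonClass X] (n : ℕ) :
    Measurable fun ω : A.RunSpace => A.history ω n := by
  induction n with
  | zero => exact measurable_const
  | succ n ih =>
    have hs : Measurable fun ω : A.RunSpace => A.sampling n (ω.1, A.history ω n) :=
      (A.measurable_sampling n).comp (measurable_fst.prodMk ih)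
    have he : Measurable fun p : X × (ℕ × X → ℝ) => p.2 (n, p.1) :=
      measurable_from_prod_countable_right fun x => measurable_pi_apply (n, x)
    exact measurable_fin_snoc ih (hs.prodMk (he.comp (hs.prodMk measurable_snd)))

theorem measurable_observation [Countable X] [MeasurableSingletonClass X] (n : ℕ) :
    Measurable (A.observation n) :=
  measurable_fst.prodMk (A.measurable_history n)

theorem history_congr (s : A.Seed) {v w : ℕ × X → ℝ} (n : ℕ)
    (h : ∀ p : ℕ × X, p.1 < n → v p = w p) : A.history (s, v) n = A.history (s, w) n := by
  induction n with
  | zero => rfl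
  | succ n ih =>
    have := ih fun p hp => h p (by omega)
    simp only [history, this]
    rw [h _ (by simp)]

theorem history_castLE (ω : A.RunSpace) {m n : ℕ} (h : m ≤ n) :
    (fun i => A.history ω n (Fin.castLE h i)) = A.history ω m := by
  induction n, h using Nat.le_induction with
  | base => rfl
  | succ n h ih =>
    rw [← ih]
    funext i
    have : Fin.castLE (Nat.le_succ_of_le h) i = (Fin.castLE h i).castSucc := rfl
    rw [this]
    simp only [history, Fin.snoc_castSucc]

/-! ### One-step conditional law and change of measure at a fixed time -/

/-- Given the observations after `n` simulations, the next output has the output law of the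
decision that the sampling rule chooses. -/
theorem lintegral_observation_succ [Finite X] [MeasurableSingletonClass X] (M : SimModel X) (n : ℕ)
    {G : A.Seed × History X (n + 1) → ℝ≥0∞} (hG : Measurable G) :
    ∫⁻ ω, G (A.observation (n + 1) ω) ∂A.runLaw M =
      ∫⁻ ω, ∫⁻ y, G (ω.1, Fin.snoc (α := fun _ => X × ℝ) (A.history ω n)
        (A.sampling n (A.observation n ω), y)) ∂M.outputLaw (A.sampling n (A.observation n ω))
        ∂A.runLaw M := by
  classical
  have := Fintype.ofFinite X
  set ν := Measure.infinitePi fun p : ℕ × X => M.outputLaw p.2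
  -- the integrand on the right, as a sum over the next decision
  have hK : ∀ x : X, Measurable fun q : (A.Seed × History X n) × ℝ =>
      G (q.1.1, Fin.snoc (α := fun _ => X × ℝ) q.1.2 (x, q.2)) := fun x =>
    hG.comp (measurable_fst.fst.prodMk
      (measurable_fin_snoc measurable_fst.snd (measurable_const.prodMk measurable_snd)))
  have hI : ∀ x : X, Measurable fun q : A.Seed × History X n =>
      ∫⁻ y, G (q.1, Fin.snoc (α := fun _ => X × ℝ) q.2 (x, y)) ∂M.outputLaw x := fun x =>
    (hK x).lintegral_prod_right'
  have hS : ∀ x : X, MeasurableSet {q | A.sampling n q = x} := fun x =>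
    A.measurable_sampling n (measurableSet_singleton x)
  have hR : Measurable fun q : A.Seed × History X n => ∫⁻ y, G (q.1,
      Fin.snoc (α := fun _ => X × ℝ) q.2 (A.sampling n q, y)) ∂M.outputLaw (A.sampling n q) := by
    have : (fun q : A.Seed × History X n => ∫⁻ y, G (q.1,
      Fin.snoc (α := fun _ => X × ℝ) q.2 (A.sampling n q, y)) ∂M.outputLaw (A.sampling n q)) =
      fun q => ∑ x, {q | A.sampling n q = x}.indicator
        (fun q => ∫⁻ y, G (q.1, Fin.snoc (α := fun _ => X × ℝ) q.2 (x, y)) ∂M.outputLaw x) q := by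
      funext q
      simp [Set.indicator_apply]
    rw [this]
    exact Finset.measurable_sum _ fun x _ => (hI x).indicator (hS x)
  refine (lintegral_prod _ (hG.comp (A.measurable_observation (n + 1))).aemeasurable).trans
    (Eq.trans ?_ (lintegral_prod _ (hR.comp (A.measurable_observation n)).aemeasurable).symm)
  refine lintegral_congr fun s => ?_
  have hq : Measurable fun v : ℕ × X → ℝ => A.observation n (s, v) :=
    (A.measurable_observation n).comp measurable_prodMk_left
  -- independence of the past and of one output
  have hind : ∀ x : X, IndepFun (fun v : ℕ × X → ℝ => A.observation n (s, v))
      (fun v => v (n, x)) ν := by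
    intro x
    have h0 : iIndepFun (fun (p : ℕ × X) (v : ℕ × X → ℝ) => v p) ν :=
      iIndepFun_infinitePi (X := fun _ y => y) fun _ => measurable_id
    -- The past reads only entries with time index below `n`, a set disjoint from `{(n, x)}`.
    have h1 := h0.indepFun_finset (Finset.range n ×ˢ Finset.univ) {(n, x)}
      (by simp) fun p => measurable_pi_apply p
    -- Extension by `0` to a full table; by `history_congr` the filler values never affect the first
    -- `n` steps.
    let φ : (↥(Finset.range n ×ˢ (Finset.univ : Finset X)) → ℝ) → ℕ × X → ℝ := fun u p =>
      if h : p ∈ Finset.range n ×ˢ (Finset.univ : Finset X) then u ⟨p, h⟩ else 0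
    have hφ : Measurable φ := by
      refine measurable_pi_iff.2 fun p => ?_
      by_cases h : p ∈ Finset.range n ×ˢ (Finset.univ : Finset X)
      · simp only [φ, dif_pos h]
        exact measurable_pi_apply _
      · simp only [φ, dif_neg h]
        exact measurable_const
    have h2 := h1.comp (hq.comp hφ)
      (measurable_pi_apply (⟨(n, x), by simp⟩ : ({(n, x)} : Finset (ℕ × X))))
    have h4 : (fun v : ℕ × X → ℝ => A.observation n (s, v)) =
        ((fun v : ℕ × X → ℝ => A.observation n (s, v)) ∘ φ) ∘ fun a i => a i := by
      funext v
      refine congrArg (Prod.mk s) (A.history_congr s n fun p hp => ?_)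
      simp [φ, hp]
    rw [h4]
    exact h2
  -- The next decision is random; restricting to the event that it equals `x` fixes the table entry,
  -- so that independence applies.
  have hstep : ∀ x : X, ∫⁻ v, {q | A.sampling n q = x}.indicator 1 (A.observation n (s, v)) *
      G (s, Fin.snoc (α := fun _ => X × ℝ) (A.history (s, v) n) (x, v (n, x))) ∂ν =
      ∫⁻ v, {q | A.sampling n q = x}.indicator 1 (A.observation n (s, v)) *
        ∫⁻ y, G (s, Fin.snoc (α := fun _ => X × ℝ) (A.history (s, v) n) (x, y))
          ∂M.outputLaw x ∂ν := by
    intro x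
    have hx : Measurable fun v : ℕ × X → ℝ => v (n, x) := measurable_pi_apply _
    have hmap : ν.map (fun v => v (n, x)) = M.outputLaw x :=
      Measure.infinitePi_map_eval (μ := fun p : ℕ × X => M.outputLaw p.2) (n, x)
    have hpair := (indepFun_iff_map_prod_eq_prod_map_map hq.aemeasurable hx.aemeasurable).1 (hind x)
    have hm : Measurable fun q : (A.Seed × History X n) × ℝ =>
        {q | A.sampling n q = x}.indicator (1 : A.Seed × History X n → ℝ≥0∞) q.1 *
          G (q.1.1, Fin.snoc (α := fun _ => X × ℝ) q.1.2 (x, q.2)) :=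
      ((measurable_one.indicator (hS x)).comp measurable_fst).mul (hK x)
    have h3 := lintegral_map (μ := ν) hm (hq.prodMk hx)
    rw [hpair, hmap, lintegral_prod _ hm.aemeasurable, lintegral_map hm.lintegral_prod_right' hq]
      at h3
    refine h3.symm.trans (lintegral_congr fun v => ?_)
    exact lintegral_const_mul (μ := M.outputLaw x)
      ({q | A.sampling n q = x}.indicator (1 : A.Seed × History X n → ℝ≥0∞)
        (A.observation n (s, v)))
      ((hK x).comp (measurable_prodMk_left (x := A.observation n (s, v))))
  have hsum : ∀ (v : ℕ × X → ℝ) (T : X → ℝ≥0∞), T (A.sampling n (A.observation n (s, v))) =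
      ∑ x, {q | A.sampling n q = x}.indicator 1 (A.observation n (s, v)) * T x := by
    intro v T
    simp [Set.indicator_apply]
  calc _ = ∫⁻ v, ∑ x, {q | A.sampling n q = x}.indicator 1 (A.observation n (s, v)) *
      G (s, Fin.snoc (α := fun _ => X × ℝ) (A.history (s, v) n) (x, v (n, x))) ∂ν :=
        lintegral_congr fun v => hsum v fun x =>
          G (s, Fin.snoc (α := fun _ => X × ℝ) (A.history (s, v) n) (x, v (n, x)))
    _ = _ := by
      rw [lintegral_finsetSum _ fun x _ => ?_, Finset.sum_congr rfl fun x _ => hstep x,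
        ← lintegral_finsetSum _ fun x _ => ?_]
      · exact lintegral_congr fun v => (hsum v fun x =>
          ∫⁻ y, G (s, Fin.snoc (α := fun _ => X × ℝ) (A.history (s, v) n) (x, y))
            ∂M.outputLaw x).symm
      · exact ((measurable_one.indicator (hS x)).comp hq).mul ((hI x).comp hq)
      · exact ((measurable_one.indicator (hS x)).comp hq).mul
          ((hK x).comp (hq.prodMk (measurable_pi_apply _)))

/-- Change of measure: if the output laws of `M'` have the densities `ρ` with respect to those of
`M`, then the observations have the product of the densities as likelihood ratio. -/
theorem lintegral_observation_change [Finite X] [MeasurableSingletonClass X] {M M' : SimModel X}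
    {ρ : X × ℝ → ℝ≥0∞} (hρ : Measurable ρ)
    (hM : ∀ x, M'.outputLaw x = (M.outputLaw x).withDensity fun y => ρ (x, y)) (n : ℕ)
    {G : A.Seed × History X n → ℝ≥0∞} (hG : Measurable G) :
    ∫⁻ ω, G (A.observation n ω) ∂A.runLaw M' =
      ∫⁻ ω, G (A.observation n ω) * ∏ t, ρ ((A.observation n ω).2 t) ∂A.runLaw M := by
  induction n with
  | zero =>
    have h0 : ∀ ω, A.observation 0 ω = (ω.1, Fin.elim0) := fun ω => rfl
    have hm : Measurable fun ω : A.RunSpace => G (ω.1, Fin.elim0) :=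
      hG.comp (measurable_fst.prodMk measurable_const)
    simp only [h0, Finset.univ_eq_empty, Finset.prod_empty, mul_one, runLaw]
    rw [lintegral_prod _ hm.aemeasurable, lintegral_prod _ hm.aemeasurable]
    simp
  | succ n ih =>
    have hprod : ∀ n, Measurable fun q : A.Seed × History X n => ∏ t, ρ (q.2 t) := fun n =>
      Finset.measurable_prod _ fun t _ => hρ.comp ((measurable_pi_apply t).comp measurable_snd)
    have hx : ∀ x : X, Measurable fun y : ℝ => ρ (x, y) := fun x => hρ.comp measurable_prodMk_left
    have hsn : ∀ (q : A.Seed × History X n) (x : X), Measurable fun y : ℝ =>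
        ((q.1, Fin.snoc (α := fun _ => X × ℝ) q.2 (x, y)) : A.Seed × History X (n + 1)) :=
      fun q x => measurable_const.prodMk
        (measurable_fin_snoc measurable_const (measurable_const.prodMk measurable_id))
    rw [A.lintegral_observation_succ M' n hG,
      A.lintegral_observation_succ M n (G := fun q => G q * ∏ t, ρ (q.2 t))
        (hG.mul (hprod (n + 1)))]
    -- Integrating out the last output absorbs the last factor of the likelihood ratio; the
    -- induction hypothesis then treats the remaining `n` factors.
    have key : ∀ (q : A.Seed × History X n) (x : X),
        ∫⁻ y, G (q.1, Fin.snoc (α := fun _ => X × ℝ) q.2 (x, y)) *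
          (∏ t, ρ ((Fin.snoc (α := fun _ => X × ℝ) q.2 (x, y) : History X (n + 1)) t))
            ∂M.outputLaw x =
        (∫⁻ y, G (q.1, Fin.snoc (α := fun _ => X × ℝ) q.2 (x, y)) ∂M'.outputLaw x) *
          ∏ t, ρ (q.2 t) := by
      intro q x
      rw [hM x]
      refine Eq.trans ?_ (congrArg (· * ∏ t, ρ (q.2 t))
        (lintegral_withDensity_eq_lintegral_mul _ (hx x) (hG.comp (hsn q x))).symm)
      refine Eq.trans ?_ (lintegral_mul_const _ ((hx x).mul (hG.comp (hsn q x))))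
      refine lintegral_congr fun y => ?_
      simp only [Fin.prod_univ_castSucc, Fin.snoc_castSucc, Fin.snoc_last, Pi.mul_apply,
        Function.comp_apply]
      ring
    have hJ : Measurable fun q : A.Seed × History X n => ∫⁻ y, G (q.1,
        Fin.snoc (α := fun _ => X × ℝ) q.2 (A.sampling n q, y)) ∂M'.outputLaw (A.sampling n q) := by
      have hK : ∀ x : X, Measurable fun q : A.Seed × History X n =>
          ∫⁻ y, G (q.1, Fin.snoc (α := fun _ => X × ℝ) q.2 (x, y)) ∂M'.outputLaw x := fun x =>
        Measurable.lintegral_prod_right' (f := fun q : (A.Seed × History X n) × ℝ =>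
          G (q.1.1, Fin.snoc (α := fun _ => X × ℝ) q.1.2 (x, q.2))) (hG.comp
          (measurable_fst.fst.prodMk (measurable_fin_snoc measurable_fst.snd
            (measurable_const.prodMk measurable_snd))))
      exact (measurable_from_prod_countable_right (f := fun p : X × (A.Seed × History X n) =>
        ∫⁻ y, G (p.2.1, Fin.snoc (α := fun _ => X × ℝ) p.2.2 (p.1, y)) ∂M'.outputLaw p.1) hK).comp
        ((A.measurable_sampling n).prodMk measurable_id)
    refine (ih hJ).trans (lintegral_congr fun ω => ?_)
    exact (key (A.observation n ω) _).symm

end SimAlgorithm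

/-! ### Stopped functionals of the observations -/

namespace SimAlgorithm

variable {X : Type} [MeasurableSpace X] (A : SimAlgorithm X)

/-- The observations after `n` simulations on which the algorithm stops exactly then. -/
def stopsAt (n : ℕ) : Set (A.Seed × History X n) :=
  {q | q ∈ A.stopping n ∧
    ∀ m : Fin n, (q.1, fun i => q.2 (Fin.castLE m.2.le i)) ∉ A.stopping m}

theorem measurableSet_stopsAt (n : ℕ) : MeasurableSet (A.stopsAt n) := by
  have hset : A.stopsAt n = A.stopping n ∩
      ⋂ m : Fin n, {q | (q.1, fun i => q.2 (Fin.castLE m.2.le i)) ∉ A.stopping m} := by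
    ext
    simp [stopsAt]
  rw [hset]
  refine (A.measurableSet_stopping n).inter ?_
  refine MeasurableSet.iInter fun m => ?_
  have : Measurable fun q : A.Seed × History X n =>
      ((q.1, fun i => q.2 (Fin.castLE m.2.le i)) : A.Seed × History X m) :=
    measurable_fst.prodMk (measurable_pi_iff.2 fun i =>
      (measurable_pi_apply (Fin.castLE m.2.le i)).comp measurable_snd)
  exact (this (A.measurableSet_stopping m)).compl

theorem observation_mem_stopsAt {n : ℕ} {ω : A.RunSpace} :
    A.observation n ω ∈ A.stopsAt n ↔
      A.observation n ω ∈ A.stopping n ∧ ∀ m < n, A.observation m ω ∉ A.stopping m := by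
  refine and_congr_right fun _ => ?_
  rw [Fin.forall_iff]
  refine forall₂_congr fun m hm => ?_
  simp only [observation]
  rw [A.history_castLE ω hm.le]

theorem stopTime_eq_coe_iff {n : ℕ} {ω : A.RunSpace} :
    A.stopTime ω = n ↔ A.observation n ω ∈ A.stopsAt n := by
  classical
  rw [observation_mem_stopsAt]
  have hle : ∀ m, A.observation m ω ∈ A.stopping m → A.stopTime ω ≤ m := fun m hm =>
    iInf₂_le (f := fun (n : ℕ) (_ : (ω.1, A.history ω n) ∈ A.stopping n) => (n : ℕ∞)) m hm
  constructor
  · intro h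
    have hlt : ∀ m < n, A.observation m ω ∉ A.stopping m := fun m hm hs =>
      absurd (hle m hs) (by rw [h]; exact not_le.2 (by exact_mod_cast hm))
    refine ⟨?_, hlt⟩
    by_contra hn
    have : ((n + 1 : ℕ) : ℕ∞) ≤ A.stopTime ω := by
      refine le_iInf₂ fun m hm => ?_
      have : n < m := by
        rcases lt_trichotomy m n with h1 | h1 | h1
        · exact absurd hm (hlt m h1)
        · exact absurd hm (h1 ▸ hn)
        · exact h1
      exact_mod_cast this
    rw [h] at this
    have : n + 1 ≤ n := by exact_mod_cast this
    omega
  · rintro ⟨hn, hlt⟩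
    refine le_antisymm (hle n hn) (le_iInf₂ fun m hm => ?_)
    have : n ≤ m := not_lt.1 fun h1 => hlt m h1 hm
    exact_mod_cast this

/-- The value of a functional of the observations at the time of stopping, `0` if the algorithm
does not stop. -/
noncomputable def stopped (w : ∀ n, A.Seed × History X n → ℝ≥0∞) (ω : A.RunSpace) : ℝ≥0∞ :=
  ∑' n, (A.stopsAt n).indicator (w n) (A.observation n ω)

variable {A} in
theorem stopped_eq {n : ℕ} {ω : A.RunSpace} (h : A.stopTime ω = n)
    (w : ∀ n, A.Seed × History X n → ℝ≥0∞) : A.stopped w ω = w n (A.observation n ω) := by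
  rw [stopped, tsum_eq_single n, Set.indicator_of_mem (A.stopTime_eq_coe_iff.1 h)]
  intro m hm
  refine Set.indicator_of_notMem (fun hs => hm ?_) _
  have := (A.stopTime_eq_coe_iff.2 hs).symm.trans h
  exact_mod_cast this

variable {A} in
theorem stopped_eq_zero {ω : A.RunSpace} (h : A.stopTime ω = ⊤)
    (w : ∀ n, A.Seed × History X n → ℝ≥0∞) : A.stopped w ω = 0 := by
  refine ENNReal.tsum_eq_zero.2 fun n => Set.indicator_of_notMem (fun hs => ?_) _
  have := (A.stopTime_eq_coe_iff.2 hs).symm.trans h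
  exact ENat.natCast_ne_top n this

/-- The likelihood ratio of the observations for the densities `ρ` of the outputs. -/
noncomputable def likelihood (ρ : X × ℝ → ℝ≥0∞) (n : ℕ) (q : A.Seed × History X n) : ℝ≥0∞ :=
  ∏ t, ρ (q.2 t)

/-- The number of simulations of the decision `x`. -/
noncomputable def visits (x : X) (n : ℕ) (q : A.Seed × History X n) : ℝ≥0∞ :=
  ∑ t, ({x} : Set X).indicator 1 (q.2 t).1

/-- The indicator of the event that the recommendation lies in `S`. -/
noncomputable def recommends (S : Set X) (n : ℕ) (q : A.Seed × History X n) : ℝ≥0∞ :=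
  S.indicator 1 (A.recommend n q)

theorem measurable_likelihood {ρ : X × ℝ → ℝ≥0∞} (hρ : Measurable ρ) (n : ℕ) :
    Measurable (A.likelihood ρ n) :=
  Finset.measurable_prod _ fun t _ => hρ.comp ((measurable_pi_apply t).comp measurable_snd)

/-- Each visit to `x₀` contributes the deterministic factor `exp (-κ)` and every other simulation
contributes `1`. -/
theorem likelihood_mul_likelihood {ρ ρ' : X × ℝ → ℝ≥0∞} {x₀ : X} {κ : ℝ}
    (h : ∀ x y, ρ (x, y) * ρ' (x, y) =
      ENNReal.ofReal (Real.exp (-(κ * ({x₀} : Set X).indicator 1 x))))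
    (n : ℕ) (q : A.Seed × History X n) :
    A.likelihood ρ n q * A.likelihood ρ' n q =
      ENNReal.ofReal (Real.exp (-(κ * (A.visits x₀ n q).toReal))) := by
  classical
  have hv : (A.visits x₀ n q).toReal = ∑ t, ({x₀} : Set X).indicator 1 (q.2 t).1 := by
    rw [visits, ENNReal.toReal_sum]
    · refine Finset.sum_congr rfl fun t _ => ?_
      simp only [Set.indicator_apply]
      split_ifs <;> simp
    · intro t _
      simp only [Set.indicator_apply]
      split_ifs <;> simp
  rw [likelihood, likelihood, ← Finset.prod_mul_distrib, hv, Finset.mul_sum,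
    ← Finset.sum_neg_distrib, Real.exp_sum, ENNReal.ofReal_prod_of_nonneg fun _ _ => by positivity]
  exact Finset.prod_congr rfl fun t _ => h _ _

theorem visits_ne_top (x : X) (n : ℕ) (q : A.Seed × History X n) : A.visits x n q ≠ ⊤ := by
  classical
  refine ENNReal.sum_ne_top.2 fun t _ => ?_
  simp only [Set.indicator_apply]
  split_ifs <;> simp

/-! ### Expectations at the stopping time -/

variable [Finite X] [MeasurableSingletonClass X]

theorem measurable_visits (x : X) (n : ℕ) : Measurable (A.visits x n) :=
  Finset.measurable_sum _ fun t _ =>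
    (measurable_of_countable (({x} : Set X).indicator (1 : X → ℝ≥0∞))).comp
      (((measurable_pi_apply t).comp measurable_snd).fst)

theorem measurable_recommends (S : Set X) (n : ℕ) : Measurable (A.recommends S n) :=
  (measurable_of_countable _).comp (A.measurable_recommend n)

theorem measurable_stopped {w : ∀ n, A.Seed × History X n → ℝ≥0∞} (hw : ∀ n, Measurable (w n)) :
    Measurable (A.stopped w) :=
  Measurable.tsum fun n =>
    ((hw n).indicator (A.measurableSet_stopsAt n)).comp (A.measurable_observation n)

/-- The event of stopping at `n` is determined by the first `n` observations, so the fixed-time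
formula applies to each term of the series. Nonnegativity makes optional stopping arguments
unnecessary; runs that never stop contribute `0` on both sides. -/
theorem lintegral_stopped_change {M M' : SimModel X} {ρ : X × ℝ → ℝ≥0∞} (hρ : Measurable ρ)
    (hM : ∀ x, M'.outputLaw x = (M.outputLaw x).withDensity fun y => ρ (x, y))
    {w : ∀ n, A.Seed × History X n → ℝ≥0∞} (hw : ∀ n, Measurable (w n)) :
    ∫⁻ ω, A.stopped w ω ∂A.runLaw M' =
      ∫⁻ ω, A.stopped (fun n q => w n q * A.likelihood ρ n q) ω ∂A.runLaw M := by
  classical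
  have hw' := fun n => (hw n).indicator (A.measurableSet_stopsAt n)
  have hwl := fun n => ((hw n).mul (A.measurable_likelihood hρ n)).indicator
    (A.measurableSet_stopsAt n)
  refine (lintegral_tsum fun n =>
    ((hw' n).comp (A.measurable_observation n)).aemeasurable).trans (Eq.trans ?_ (lintegral_tsum
      fun n => ((hwl n).comp (A.measurable_observation n)).aemeasurable).symm)
  refine tsum_congr fun n => ?_
  refine (A.lintegral_observation_change hρ hM n (hw' n)).trans (lintegral_congr fun ω => ?_)
  simp only [Function.comp_apply, Set.indicator_apply, likelihood, Pi.mul_apply]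
  split_ifs <;> simp

theorem returnProb_eq (M : SimModel X) (S : Set X) :
    A.returnProb M S = ∫⁻ ω, A.stopped (A.recommends S) ω ∂A.runLaw M := by
  have : A.stopped (A.recommends S) = Set.indicator {ω | ∃ n : ℕ, A.stopTime ω = n ∧
      A.recommend n (ω.1, A.history ω n) ∈ S} 1 := by
    classical
    funext ω
    rcases h : A.stopTime ω with _ | n
    · rw [stopped_eq_zero h, Set.indicator_of_notMem]
      rintro ⟨n, hn, -⟩
      exact ENat.natCast_ne_top n (hn.symm.trans h)
    · have h' : A.stopTime ω = n := h
      rw [stopped_eq h', recommends, Set.indicator_apply, Set.indicator_apply]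
      refine if_congr ⟨fun hr => ⟨n, h', hr⟩, ?_⟩ rfl rfl
      rintro ⟨m, hm, hr⟩
      have : n = m := by exact_mod_cast h'.symm.trans hm
      exact this ▸ hr
  have hm := A.measurable_stopped (A.measurable_recommends S)
  rw [this] at hm ⊢
  rw [lintegral_indicator_one, returnProb]
  exact (measurable_indicator_const_iff (1 : ℝ≥0∞)).1 hm

theorem returnProb_add_le (M : SimModel X) {S T : Set X} (hST : Disjoint S T) :
    A.returnProb M S + A.returnProb M T ≤ 1 := by
  rw [returnProb_eq, returnProb_eq,
    ← lintegral_add_left (A.measurable_stopped (A.measurable_recommends S))]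
  have : IsProbabilityMeasure (A.runLaw M) := by unfold runLaw; infer_instance
  refine (lintegral_mono (g := 1) fun ω => ?_).trans (by simp)
  rcases h : A.stopTime ω with _ | n
  · simp [stopped_eq_zero h]
  · rw [stopped_eq (n := n) h, stopped_eq (n := n) h]
    refine (congrFun (Set.indicator_union_of_disjoint hST (1 : X → ℝ≥0∞)) _).symm.trans_le ?_
    exact Set.indicator_le_self' (fun _ _ => zero_le) _

/-- Every simulation counts as a visit to at most one point of `T`. -/
theorem sum_lintegral_visits_le (M : SimModel X) (T : Finset X) :
    ∑ x ∈ T, ∫⁻ ω, A.stopped (A.visits x) ω ∂A.runLaw M ≤ A.expectedCost M := by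
  classical
  rw [← lintegral_finsetSum _ fun x _ => A.measurable_stopped (A.measurable_visits x), expectedCost]
  refine lintegral_mono fun ω => ?_
  rcases h : A.stopTime ω with _ | n
  · simp [stopped_eq_zero h]
  · simp only [stopped_eq (n := n) h, visits]
    rw [Finset.sum_comm]
    refine (Finset.sum_le_card_nsmul _ _ 1 fun t _ => ?_).trans (le_of_eq ?_)
    · simp only [Set.indicator_apply, Set.mem_singleton_iff, Finset.sum_ite_eq, Pi.one_apply]
      split_ifs <;> simp
    · simp
      rfl

/-! ### Expected visits needed to separate two models -/

/-- If the models `M` and `M'` differ only in the output at the decision `x₀`, and require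
recommendations in the disjoint sets `S` and `S'`, then `x₀` has to be simulated often on `M`. The
model `M''` is the reflection of `M'` at `M`. -/
theorem le_lintegral_visits {M M' M'' : SimModel X} {ρ ρ' : X × ℝ → ℝ≥0∞} (hρ : Measurable ρ)
    (hρ' : Measurable ρ')
    (hM : ∀ x, M'.outputLaw x = (M.outputLaw x).withDensity fun y => ρ (x, y))
    (hM' : ∀ x, M''.outputLaw x = (M.outputLaw x).withDensity fun y => ρ' (x, y))
    {x₀ : X} {κ : ℝ} (hκ : 0 < κ)
    (h : ∀ x y, ρ (x, y) * ρ' (x, y) =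
      ENNReal.ofReal (Real.exp (-(κ * ({x₀} : Set X).indicator 1 x))))
    {S S' : Set X} (hS : Disjoint S S') {δ : ℝ} (hδ : 0 < δ) (hδ' : δ ≤ 1 / 1000)
    (h1 : ENNReal.ofReal (1 - δ) ≤ A.returnProb M S)
    (h2 : ENNReal.ofReal (1 - δ) ≤ A.returnProb M' S') :
    ENNReal.ofReal (Real.log (1 / δ) / (8 * κ)) ≤
      ∫⁻ ω, A.stopped (A.visits x₀) ω ∂A.runLaw M := by
  have hM''prob : IsProbabilityMeasure (A.runLaw M'') := by unfold runLaw; infer_instance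
  -- With this `b`, fewer than `4 * b` visits keep the product of the two ratios above `exp (-4κb) =
  -- √δ`.
  set b := Real.log (1 / δ) / (8 * κ) with hb
  have hlog : 0 < Real.log (1 / δ) := Real.log_pos (by rw [lt_div_iff₀ hδ]; linarith)
  have hb0 : 0 < b := by positivity
  have hsq : 0 < √δ := Real.sqrt_pos.2 hδ
  have hexp : Real.exp (-(κ * (4 * b))) = √δ := by
    have : -(κ * (4 * b)) = Real.log δ / 2 := by
      rw [hb, one_div, Real.log_inv]; field_simp; ring
    rw [this, ← Real.log_sqrt hδ.le, Real.exp_log hsq]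
  by_contra! hlt
  -- the pointwise inequality
  have hpt : ∀ ω, A.stopped (A.recommends S) ω ≤ ENNReal.ofReal (4 / √δ) *
      A.stopped (fun n q => A.recommends S n q * A.likelihood ρ n q) ω +
      (ENNReal.ofReal (1 / (4 * b)) * A.stopped (A.visits x₀) ω +
      ENNReal.ofReal (1 / 4) * A.stopped (fun n q => 1 * A.likelihood ρ' n q) ω) := by
    intro ω
    rcases hτ : A.stopTime ω with _ | n
    · simp [stopped_eq_zero hτ]
    simp only [stopped_eq (n := n) hτ, one_mul]
    set q := A.observation n ω
    by_cases hr : A.recommend n q ∈ S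
    swap
    · simp [recommends, hr]
    have hr1 : A.recommends S n q = 1 := by simp [recommends, hr]
    rw [hr1, one_mul]
    -- Three cases, one per summand: many visits, a large reflected ratio, or neither; in the last
    -- case the ratio of `M'` is at least `√δ / 4`.
    by_cases hv : 4 * b ≤ (A.visits x₀ n q).toReal
    · refine le_add_left (le_add_right ?_)
      rw [← ENNReal.ofReal_toReal (A.visits_ne_top x₀ n q), ← ENNReal.ofReal_mul (by positivity),
        ENNReal.one_le_ofReal, one_div, ← div_eq_inv_mul, le_div_iff₀ (by positivity)]
      linarith
    by_cases hl : 4 ≤ A.likelihood ρ' n q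
    · refine le_add_left (le_add_left ?_)
      calc (1 : ℝ≥0∞) = ENNReal.ofReal (1 / 4) * ENNReal.ofReal 4 := by
            rw [← ENNReal.ofReal_mul (by norm_num)]; norm_num
        _ ≤ _ := by gcongr; simpa using hl
    · refine le_add_right ?_
      push Not at hv hl
      have h3 : ENNReal.ofReal (√δ) ≤ A.likelihood ρ n q * ENNReal.ofReal 4 := by
        calc ENNReal.ofReal (√δ) ≤ A.likelihood ρ n q * A.likelihood ρ' n q := by
              rw [A.likelihood_mul_likelihood h, ← hexp]
              gcongr
          _ ≤ _ := by gcongr; simpa using hl.le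
      calc (1 : ℝ≥0∞) = ENNReal.ofReal (1 / √δ) * ENNReal.ofReal (√δ) := by
            rw [← ENNReal.ofReal_mul (by positivity), one_div_mul_cancel hsq.ne',
              ENNReal.ofReal_one]
        _ ≤ ENNReal.ofReal (1 / √δ) * (A.likelihood ρ n q * ENNReal.ofReal 4) := by gcongr
        _ = ENNReal.ofReal (1 / √δ) * ENNReal.ofReal 4 * A.likelihood ρ n q := by ring
        _ = _ := by
          rw [← ENNReal.ofReal_mul (by positivity)]
          congr 2
          ring
  -- the integrals
  have hm1 : Measurable (A.stopped fun n q => A.recommends S n q * A.likelihood ρ n q) :=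
    A.measurable_stopped fun n => (A.measurable_recommends S n).mul (A.measurable_likelihood hρ n)
  have hm2 := A.measurable_stopped (A.measurable_visits x₀)
  have hm3 : Measurable (A.stopped fun n q => 1 * A.likelihood ρ' n q) :=
    A.measurable_stopped fun n => measurable_const.mul (A.measurable_likelihood hρ' n)
  -- This is the probability that `M'` returns a point of `S`, hence a point outside `S'`.
  have hI1 : ∫⁻ ω, A.stopped (fun n q => A.recommends S n q * A.likelihood ρ n q) ω ∂A.runLaw M ≤
      ENNReal.ofReal δ := by
    rw [← A.lintegral_stopped_change hρ hM (A.measurable_recommends S), ← returnProb_eq]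
    have h4 := (add_le_add_right h2 _).trans (A.returnProb_add_le M' hS)
    refine (ENNReal.le_sub_of_add_le_right ENNReal.ofReal_ne_top h4).trans (le_of_eq ?_)
    rw [← ENNReal.ofReal_one, ← ENNReal.ofReal_sub _ (by linarith)]
    congr 1
    ring
  -- This is the probability of stopping on `M''`; no guarantee on `M''` is needed.
  have hI3 : ∫⁻ ω, A.stopped (fun n q => 1 * A.likelihood ρ' n q) ω ∂A.runLaw M ≤ 1 := by
    rw [← A.lintegral_stopped_change hρ' hM' (w := fun _ _ => 1) fun n => measurable_const]
    refine (lintegral_mono (g := 1) fun ω => ?_).trans (by simp)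
    rcases hτ : A.stopTime ω with _ | n
    · simp [stopped_eq_zero hτ]
    · simp [stopped_eq (n := n) hτ]
  have hint : A.returnProb M S ≤ ENNReal.ofReal (4 / √δ) * ENNReal.ofReal δ +
      (ENNReal.ofReal (1 / (4 * b)) * ENNReal.ofReal b + ENNReal.ofReal (1 / 4) * 1) := by
    rw [returnProb_eq]
    refine (lintegral_mono hpt).trans ?_
    rw [lintegral_add_left (hm1.const_mul _), lintegral_add_left (hm2.const_mul _),
      lintegral_const_mul _ hm1, lintegral_const_mul _ hm2, lintegral_const_mul _ hm3]
    gcongr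
  have hfin := h1.trans hint
  rw [mul_one, ← ENNReal.ofReal_mul (by positivity), ← ENNReal.ofReal_mul (by positivity),
    ← ENNReal.ofReal_add (by positivity) (by positivity),
    ← ENNReal.ofReal_add (by positivity) (by positivity),
    ENNReal.ofReal_le_ofReal_iff (by positivity)] at hfin
  have e1 : 4 / √δ * δ = 4 * √δ := by
    rw [div_mul_eq_mul_div, div_eq_iff hsq.ne', mul_assoc, Real.mul_self_sqrt hδ.le]
  have e2 : 1 / (4 * b) * b = 1 / 4 := by field_simp
  -- The contradiction is `1 - δ ≤ 4√δ + 1/4 + 1/4 ≤ 9/10`.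
  have e3 : √δ ≤ 1 / 10 := Real.sqrt_le_iff.2 ⟨by norm_num, by linarith⟩
  rw [e1, e2] at hfin
  linarith

end SimAlgorithm

/-! ### A family of `L♮`-convex functions -/

section LNatural

variable {N d : ℕ}

theorem ceilMidpoint_add_floorMidpoint (x y : DecisionSet N d) (i : Fin d) :
    ((ceilMidpoint x y i : ℤ) + floorMidpoint x y i = x i + y i) ∧
      (0 ≤ (ceilMidpoint x y i : ℤ) - floorMidpoint x y i) ∧
      ((ceilMidpoint x y i : ℤ) - floorMidpoint x y i ≤ 1) := by
  simp only [ceilMidpoint, floorMidpoint]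
  generalize (x i : ℤ) = a
  generalize (y i : ℤ) = b
  rw [← Int.cast_add]
  obtain ⟨m, hm | hm⟩ := Int.even_or_odd' (a + b)
  · have hc : ⌈((a + b : ℤ) : ℚ) / 2⌉ = m := by
      rw [Int.ceil_eq_iff, hm]; push_cast; constructor <;> linarith
    have hf : ⌊((a + b : ℤ) : ℚ) / 2⌋ = m := by
      rw [Int.floor_eq_iff, hm]; push_cast; constructor <;> linarith
    rw [hc, hf]
    omega
  · have hc : ⌈((a + b : ℤ) : ℚ) / 2⌉ = m + 1 := by
      rw [Int.ceil_eq_iff, hm]; push_cast; constructor <;> linarith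
    have hf : ⌊((a + b : ℤ) : ℚ) / 2⌋ = m := by
      rw [Int.floor_eq_iff, hm]; push_cast; constructor <;> linarith
    rw [hc, hf]
    omega

/-- A nonnegative strictly `L♮`-convex function, which vanishes on a maximal chain of
`{1, 2}^d`. -/
def chainPenalty (x : DecisionSet N d) : ℤ :=
  ∑ i, ((x i : ℤ) - 1) * ((x i : ℤ) - 2) +
    ∑ i, ∑ j, if i < j then ((x j : ℤ) - x i) * ((x j : ℤ) - x i + 1) else 0

/-- No integer lies strictly between the roots `0` and `-r`. -/
theorem Int.mul_add_nonneg_of_abs_le_one {k r : ℤ} (h1 : -1 ≤ r) (h2 : r ≤ 1) :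
    0 ≤ k * (k + r) := by
  rcases lt_trichotomy k 0 with h | h | h
  · exact mul_nonneg_of_nonpos_of_nonpos h.le (by omega)
  · simp [h]
  · exact mul_nonneg h.le (by omega)

theorem chainPenalty_nonneg (x : DecisionSet N d) : 0 ≤ chainPenalty x := by
  refine add_nonneg (Finset.sum_nonneg fun i _ => ?_)
    (Finset.sum_nonneg fun i _ => Finset.sum_nonneg fun j _ => ?_)
  · rw [mul_comm]
    have := Int.mul_add_nonneg_of_abs_le_one (k := (x i : ℤ) - 2) (r := 1) (by norm_num) le_rfl
    calc (0 : ℤ) ≤ _ := this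
      _ = _ := by ring
  · split_ifs
    · exact Int.mul_add_nonneg_of_abs_le_one (by norm_num) le_rfl
    · exact le_rfl

/-- For a quadratic with leading coefficient `1`, the midpoint deficit is `2k(k + r)`, where `k` is
the offset of `x` from the rounded-up midpoint and `r ∈ {0, 1}` the rounding gap; the pair terms
give the same with differences. All deficits are nonnegative integers. If all vanish, the coordinate
terms force `k i ∈ {0, -r i}`, and the pair terms force the same choice in all coordinates, which
excludes incomparable `x` and `y`. -/
theorem chainPenalty_midpoint (x y : DecisionSet N d) :
    (ceilMidpoint x y = x ∧ floorMidpoint x y = y) ∨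
      (ceilMidpoint x y = y ∧ floorMidpoint x y = x) ∨
      chainPenalty (ceilMidpoint x y) + chainPenalty (floorMidpoint x y) + 1 ≤
        chainPenalty x + chainPenalty y := by
  obtain ⟨c, hc⟩ : ∃ c, c = ceilMidpoint x y := ⟨_, rfl⟩
  obtain ⟨f, hf⟩ : ∃ f, f = floorMidpoint x y := ⟨_, rfl⟩
  have hmid := ceilMidpoint_add_floorMidpoint x y
  rw [← hc, ← hf] at *
  obtain ⟨k, hk⟩ : ∃ k : Fin d → ℤ, ∀ i, k i = x i - c i := ⟨_, fun _ => rfl⟩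
  obtain ⟨r, hr⟩ : ∃ r : Fin d → ℤ, ∀ i, r i = c i - f i := ⟨_, fun _ => rfl⟩
  have hx : ∀ i, (x i : ℤ) = f i + r i + k i := fun i => by rw [hk, hr]; ring
  have hy : ∀ i, (y i : ℤ) = f i - k i := fun i => by rw [hk]; linarith [(hmid i).1]
  have hcf : ∀ i, (c i : ℤ) = f i + r i := fun i => by rw [hr]; ring
  have hr0 : ∀ i, 0 ≤ r i := fun i => by rw [hr]; exact (hmid i).2.1
  have hr1 : ∀ i, r i ≤ 1 := fun i => by rw [hr]; exact (hmid i).2.2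
  have hu : ∀ i, 0 ≤ k i * (k i + r i) := fun i =>
    Int.mul_add_nonneg_of_abs_le_one (by linarith [hr0 i]) (hr1 i)
  have hv : ∀ i j, 0 ≤ if i < j then (k j - k i) * (k j - k i + (r j - r i)) else 0 := by
    intro i j
    split_ifs
    · exact Int.mul_add_nonneg_of_abs_le_one (by linarith [hr0 j, hr1 i])
        (by linarith [hr1 j, hr0 i])
    · exact le_rfl
  have hV : ∀ i ∈ Finset.univ, 0 ≤
      ∑ j, if i < j then (k j - k i) * (k j - k i + (r j - r i)) else 0 :=
    fun i _ => Finset.sum_nonneg fun j _ => hv i j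
  have hU := Finset.sum_nonneg fun i (_ : i ∈ Finset.univ) => hu i
  have hW := Finset.sum_nonneg hV
  have heq : chainPenalty x + chainPenalty y = chainPenalty c + chainPenalty f +
      2 * (∑ i, k i * (k i + r i) +
        ∑ i, ∑ j, if i < j then (k j - k i) * (k j - k i + (r j - r i)) else 0) := by
    have e1 : ∑ i, ((x i : ℤ) - 1) * ((x i : ℤ) - 2) + ∑ i, ((y i : ℤ) - 1) * ((y i : ℤ) - 2) =
        ∑ i, ((c i : ℤ) - 1) * ((c i : ℤ) - 2) + ∑ i, ((f i : ℤ) - 1) * ((f i : ℤ) - 2) +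
          2 * ∑ i, k i * (k i + r i) := by
      rw [Finset.mul_sum, ← Finset.sum_add_distrib, ← Finset.sum_add_distrib,
        ← Finset.sum_add_distrib]
      refine Finset.sum_congr rfl fun i _ => ?_
      rw [hx, hy, hcf]
      ring
    have e2 : (∑ i, ∑ j, if i < j then ((x j : ℤ) - x i) * ((x j : ℤ) - x i + 1) else 0) +
        (∑ i, ∑ j, if i < j then ((y j : ℤ) - y i) * ((y j : ℤ) - y i + 1) else 0) =
        (∑ i, ∑ j, if i < j then ((c j : ℤ) - c i) * ((c j : ℤ) - c i + 1) else 0) +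
        (∑ i, ∑ j, if i < j then ((f j : ℤ) - f i) * ((f j : ℤ) - f i + 1) else 0) +
          2 * ∑ i, ∑ j, if i < j then (k j - k i) * (k j - k i + (r j - r i)) else 0 := by
      simp only [Finset.mul_sum, ← Finset.sum_add_distrib]
      refine Finset.sum_congr rfl fun i _ => Finset.sum_congr rfl fun j _ => ?_
      split_ifs
      · rw [hx, hy, hcf, hx i, hy i, hcf i]
        ring
      · ring
    unfold chainPenalty
    linarith
  by_cases hpos : ∑ i, k i * (k i + r i) = 0 ∧
      ∑ i, ∑ j, (if i < j then (k j - k i) * (k j - k i + (r j - r i)) else 0) = 0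
  swap
  · right; right
    have : 0 < ∑ i, k i * (k i + r i) +
        ∑ i, ∑ j, (if i < j then (k j - k i) * (k j - k i + (r j - r i)) else 0) := by
      by_contra hle
      exact hpos ⟨by omega, by omega⟩
    omega
  obtain ⟨h1, h2⟩ := hpos
  have hu0 : ∀ i, k i = 0 ∨ k i + r i = 0 := fun i => mul_eq_zero.1
    ((Finset.sum_eq_zero_iff_of_nonneg fun i _ => hu i).1 h1 i (Finset.mem_univ i))
  have hv0 : ∀ i j, i < j → k j - k i = 0 ∨ k j - k i + (r j - r i) = 0 := by
    intro i j hij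
    have h3 := (Finset.sum_eq_zero_iff_of_nonneg hV).1 h2 i (Finset.mem_univ i)
    have h4 := (Finset.sum_eq_zero_iff_of_nonneg fun j _ => hv i j).1 h3 j (Finset.mem_univ j)
    rw [if_pos hij] at h4
    exact mul_eq_zero.1 h4
  by_cases hk0 : ∀ i, k i = 0
  · left
    constructor <;> funext i <;> refine Subtype.ext ?_
    · rw [hcf, hx, hk0, add_zero]
    · rw [hy, hk0, sub_zero]
  · right; left
    push Not at hk0
    obtain ⟨i, hi⟩ := hk0
    -- Here `k i = -1` and `r i = 1`; a `j` with `k j = 0` and `r j = 1` would violate the pair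
    -- condition.
    have hkr : ∀ j, k j + r j = 0 := by
      intro j
      have a1 := hr0 i
      have a2 := hr1 i
      have a3 := hr0 j
      have a4 := hr1 j
      rcases lt_trichotomy i j with h | h | h
      · rcases hu0 i, hu0 j, hv0 i j h with ⟨h5 | h5, h6 | h6, h7 | h7⟩ <;> omega
      · have := (hu0 i).resolve_left hi
        rwa [h] at this
      · rcases hu0 i, hu0 j, hv0 j i h with ⟨h5 | h5, h6 | h6, h7 | h7⟩ <;> omega
    constructor <;> funext j <;> refine Subtype.ext ?_
    · rw [hcf, hy]; linarith [hkr j]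
    · rw [hx]; linarith [hkr j]

/-- A perturbation with values in `[-B, 0]` costs at most `2 * B` in a midpoint inequality, and the
penalty gains at least `K` unless the inequality is trivial. -/
theorem LNaturalConvex.chainPenalty_add {B K : ℝ} {h : DecisionSet N d → ℝ}
    (h1 : ∀ x, -B ≤ h x) (h2 : ∀ x, h x ≤ 0) (hK : 2 * B ≤ K) (hK0 : 0 ≤ K) :
    LNaturalConvex fun x => K * chainPenalty x + h x := by
  intro x y
  rcases chainPenalty_midpoint x y with ⟨hc, hf⟩ | ⟨hc, hf⟩ | hle
  · simp only [hc, hf, le_refl]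
  · simp only [hc, hf]
    rw [add_comm]
  · have hle' : (chainPenalty (ceilMidpoint x y) : ℝ) + chainPenalty (floorMidpoint x y) + 1 ≤
        chainPenalty x + chainPenalty y := by exact_mod_cast hle
    have := mul_le_mul_of_nonneg_left hle' hK0
    linarith [h1 x, h1 y, h2 (ceilMidpoint x y), h2 (floorMidpoint x y)]

/-- The point `(2, …, 2, 1, …, 1)` with `k` leading entries `2`. -/
def chainPoint (hN : 2 ≤ N) (k : ℕ) : DecisionSet N d := fun i =>
  ⟨if (i : ℕ) < k then 2 else 1, by split_ifs <;> constructor <;> omega⟩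

theorem chainPenalty_chainPoint (hN : 2 ≤ N) (k : ℕ) :
    chainPenalty (chainPoint hN k : DecisionSet N d) = 0 := by
  have h1 : ∀ i : Fin d, ((chainPoint hN k i : ℤ) - 1) * ((chainPoint hN k i : ℤ) - 2) = 0 := by
    intro i
    simp only [chainPoint]
    split_ifs <;> norm_num
  have h2 : ∀ i j : Fin d, (if i < j then ((chainPoint hN k j : ℤ) - chainPoint hN k i) *
      ((chainPoint hN k j : ℤ) - chainPoint hN k i + 1) else 0) = 0 := by
    intro i j
    simp only [chainPoint]
    split_ifs <;> omega
  simp only [chainPenalty, h1, h2, Finset.sum_const_zero, add_zero]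

theorem chainPoint_injOn (hN : 2 ≤ N) :
    Set.InjOn (fun k => (chainPoint hN k : DecisionSet N d)) (Set.Iic d) := by
  have key : ∀ k l, k < l → l ≤ d → (chainPoint hN k : DecisionSet N d) ≠ chainPoint hN l := by
    intro k l hkl hl h
    have := congrArg Subtype.val (congrFun h ⟨k, by omega⟩)
    simp [chainPoint, hkl] at this
  intro k hk l hl h
  rcases lt_trichotomy k l with h' | h' | h'
  · exact absurd h (key k l h' hl)
  · exact h'
  · exact absurd h.symm (key l k h' hk)

end LNatural

/-! ### Gaussian models -/

section Gaussian

variable {X : Type}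

/-- The model with output `𝒩(f x, σ²)` at the decision `x`. -/
noncomputable def gaussianModel (f : X → ℝ) (σ : ℝ≥0) : SimModel X where
  Y := ℝ
  xiLaw x := gaussianReal (f x) (σ ^ 2)
  F _ y := y
  measurable_F _ := measurable_id

@[simp]
theorem gaussianModel_objective (f : X → ℝ) (σ : ℝ≥0) : (gaussianModel f σ).objective = f :=
  funext fun _ => integral_id_gaussianReal

@[simp]
theorem gaussianModel_outputLaw (f : X → ℝ) (σ : ℝ≥0) (x : X) :
    (gaussianModel f σ).outputLaw x = gaussianReal (f x) (σ ^ 2) :=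
  Measure.map_id

theorem gaussianModel_mem_gaussianConvexModels {N d : ℕ} {f : DecisionSet N d → ℝ}
    (hf : LNaturalConvex f) (σ : ℝ≥0) : gaussianModel f σ ∈ gaussianConvexModels N d σ :=
  ⟨by simpa using hf, by simp⟩

theorem gaussianModel_mem_convexModels {N d : ℕ} {f : DecisionSet N d → ℝ}
    (hf : LNaturalConvex f) (σ : ℝ≥0) : gaussianModel f σ ∈ convexModels N d σ := by
  refine ⟨by simpa using hf, fun x => ?_⟩
  rw [gaussianModel_objective]
  change HasSubgaussianMGF (fun y => y - f x) (σ ^ 2) (gaussianReal (f x) (σ ^ 2))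
  have hmap : (gaussianReal (f x) (σ ^ 2)).map (fun y => y - f x) = gaussianReal 0 (σ ^ 2) := by
    simpa using gaussianReal_map_sub_const (μ := f x) (v := σ ^ 2) (f x)
  constructor
  · intro t
    have := integrable_exp_mul_gaussianReal (μ := 0) (v := σ ^ 2) t
    rw [← hmap] at this
    exact this.comp_measurable (by fun_prop)
  · intro t
    rw [mgf_gaussianReal hmap]
    simp

/-- The density of `𝒩(μ + Δ, σ²)` with respect to `𝒩(μ, σ²)`. -/
noncomputable def gaussianShiftDensity (μ Δ : ℝ) (σ : ℝ≥0) (y : ℝ) : ℝ≥0∞ :=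
  ENNReal.ofReal (Real.exp ((Δ * (y - μ) - Δ ^ 2 / 2) / (σ : ℝ) ^ 2))

theorem measurable_gaussianShiftDensity (μ Δ : ℝ) (σ : ℝ≥0) :
    Measurable (gaussianShiftDensity μ Δ σ) := by
  unfold gaussianShiftDensity
  fun_prop

theorem gaussianReal_shift (μ Δ : ℝ) {σ : ℝ≥0} (hσ : 0 < σ) :
    gaussianReal (μ + Δ) (σ ^ 2) =
      (gaussianReal μ (σ ^ 2)).withDensity (gaussianShiftDensity μ Δ σ) := by
  have hσ' : σ ^ 2 ≠ 0 := by positivity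
  have hσr : (σ : ℝ) ≠ 0 := by exact_mod_cast hσ.ne'
  rw [gaussianReal_of_var_ne_zero _ hσ', gaussianReal_of_var_ne_zero _ hσ',
    ← withDensity_mul _ (measurable_gaussianPDF _ _) (measurable_gaussianShiftDensity _ _ _)]
  congr 1
  funext y
  simp only [Pi.mul_apply, gaussianPDF, gaussianPDFReal, gaussianShiftDensity]
  rw [← ENNReal.ofReal_mul (by positivity), mul_assoc _ (Real.exp _), ← Real.exp_add]
  congr 3
  push_cast
  field_simp
  ring

/-- The densities of the outputs of a Gaussian model with mean shifted by `Δ` at `x₀`. -/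
noncomputable def shiftDensity [DecidableEq X] (f : X → ℝ) (x₀ : X) (Δ : ℝ) (σ : ℝ≥0)
    (p : X × ℝ) : ℝ≥0∞ :=
  if p.1 = x₀ then gaussianShiftDensity (f x₀) Δ σ p.2 else 1

variable [DecidableEq X]

theorem measurable_shiftDensity [MeasurableSpace X] [MeasurableSingletonClass X] (f : X → ℝ)
    (x₀ : X) (Δ : ℝ) (σ : ℝ≥0) : Measurable (shiftDensity f x₀ Δ σ) :=
  Measurable.ite (measurable_fst (measurableSet_singleton x₀))
    ((measurable_gaussianShiftDensity _ _ _).comp measurable_snd) measurable_const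

theorem gaussianModel_update_outputLaw (f : X → ℝ) (x₀ : X) (Δ : ℝ) {σ : ℝ≥0} (hσ : 0 < σ)
    (x : X) : (gaussianModel (Function.update f x₀ (f x₀ + Δ)) σ).outputLaw x =
      ((gaussianModel f σ).outputLaw x).withDensity fun y => shiftDensity f x₀ Δ σ (x, y) := by
  rw [gaussianModel_outputLaw, gaussianModel_outputLaw]
  by_cases h : x = x₀
  · subst h
    simpa [shiftDensity] using gaussianReal_shift (f x) Δ hσ
  · simp [shiftDensity, h, withDensity_const]

/-- The terms linear in `y` cancel for opposite shifts, leaving `κ = Δ² / σ²`. -/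
theorem shiftDensity_mul_shiftDensity_neg (f : X → ℝ) (x₀ : X) (Δ : ℝ) (σ : ℝ≥0) (x : X) (y : ℝ) :
    shiftDensity f x₀ Δ σ (x, y) * shiftDensity f x₀ (-Δ) σ (x, y) =
      ENNReal.ofReal (Real.exp (-(Δ ^ 2 / (σ : ℝ) ^ 2 * ({x₀} : Set X).indicator 1 x))) := by
  by_cases h : x = x₀
  · simp only [shiftDensity, h, if_true, gaussianShiftDensity, Set.indicator_of_mem,
      Set.mem_singleton_iff, Pi.one_apply]
    rw [← ENNReal.ofReal_mul (by positivity), ← Real.exp_add]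
    congr 2
    ring
  · simp [shiftDensity, h]

end Gaussian

/-! ### The lower bound -/

/-- Only Gaussian models serve as hard instances, so one bound covers both classes. -/
theorem le_expectedCost_of_gaussianModel {N d : ℕ} (hN : 2 ≤ N) {σ : ℝ≥0} (hσ : 0 < σ) {ε δ : ℝ}
    (hε : 0 < ε) (hδ : 0 < δ) (hδ' : δ ≤ 1 / 1000) {𝓜 : Set (SimModel (DecisionSet N d))}
    (h𝓜 : ∀ f : DecisionSet N d → ℝ, LNaturalConvex f → gaussianModel f σ ∈ 𝓜) :
    ENNReal.ofReal (1 / 128 * (d * (σ : ℝ) ^ 2 / ε ^ 2 * Real.log (1 / δ))) ≤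
      simulationCost (PGS ε δ) 𝓜 := by
  classical
  let C : ℕ → DecisionSet N d := chainPoint hN
  have hCinj : Set.InjOn C (Set.Iic d) := chainPoint_injOn hN
  have hC0 : ∀ k, (chainPenalty (C k) : ℝ) = 0 := fun k => by
    exact_mod_cast chainPenalty_chainPoint hN k
  have hp : ∀ x : DecisionSet N d, (0 : ℝ) ≤ 8 * ε * chainPenalty x := fun x =>
    mul_nonneg (by positivity) (by exact_mod_cast chainPenalty_nonneg x)
  let g : DecisionSet N d → ℝ := fun x => if x = C 0 then -(2 * ε) else 0
  have hg : ∀ x, g x ≤ 0 ∧ -(2 * ε) ≤ g x := fun x => by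
    simp only [g]
    split_ifs <;> constructor <;> linarith
  let f : DecisionSet N d → ℝ := fun x => 8 * ε * chainPenalty x + g x
  -- The bound `4 * ε` and the factor `8 * ε` are dictated by the alternatives `f'`, which dip to
  -- `-4ε`.
  have hf : LNaturalConvex f := LNaturalConvex.chainPenalty_add (B := 4 * ε)
    (fun x => by linarith [(hg x).2]) (fun x => (hg x).1) (by linarith) (by linarith)
  have hf0 : f (C 0) = -(2 * ε) := by simp [f, g, hC0]
  have hf1 : ∀ x, x ≠ C 0 → 0 ≤ f x := fun x hx => by simpa [f, g, hx] using hp x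
  have hf2 : ∀ x, -(2 * ε) ≤ f x := fun x => by linarith [(hg x).2, hp x]
  refine le_iInf₂ fun A hA => ?_
  refine le_trans ?_ (le_iSup₂ (f := fun M (_ : M ∈ 𝓜) => A.expectedCost M) _ (h𝓜 f hf))
  have hCk : ∀ k ∈ Finset.Icc 1 d, C k ≠ C 0 := by
    intro k hk h
    rw [Finset.mem_Icc] at hk
    have := hCinj (Set.mem_Iic.2 hk.2) (Set.mem_Iic.2 (Nat.zero_le d)) h
    omega
  have harm : ∀ k ∈ Finset.Icc 1 d, ENNReal.ofReal (Real.log (1 / δ) /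
      (8 * ((-(4 * ε)) ^ 2 / (σ : ℝ) ^ 2))) ≤
        ∫⁻ ω, A.stopped (A.visits (C k)) ω ∂A.runLaw (gaussianModel f σ) := by
    intro k hk
    let f' := Function.update f (C k) (f (C k) + -(4 * ε))
    have hfk : f (C k) = 0 := by simp [f, g, hC0, hCk k hk]
    have hf'k : f' (C k) = -(4 * ε) := by simp [f', hfk]
    have hf'1 : ∀ x, x ≠ C k → f' x = f x := fun x hx => by simp [f', hx]
    have hf' : LNaturalConvex f' := by
      have := LNaturalConvex.chainPenalty_add (N := N) (d := d) (B := 4 * ε) (K := 8 * ε)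
        (h := Function.update g (C k) (-(4 * ε)))
        (fun x => by
          rcases eq_or_ne x (C k) with rfl | hx
          · simp
          · rw [Function.update_of_ne hx]; linarith [(hg x).2])
        (fun x => by
          rcases eq_or_ne x (C k) with rfl | hx
          · simp [hε.le]
          · rw [Function.update_of_ne hx]; exact (hg x).1) (by linarith) (by linarith)
      convert this using 1
      funext x
      rcases eq_or_ne x (C k) with rfl | hx
      · simp [hf'k, hC0]
      · rw [hf'1 x hx, Function.update_of_ne hx]
    -- In both models the best point beats all others by at least `2ε > ε`.
    have hdisj : Disjoint {x | ∀ y, f x - f y ≤ ε} {x | ∀ y, f' x - f' y ≤ ε} := by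
      rw [Set.disjoint_left]
      intro x hx hx'
      have h1 : x = C 0 := by
        by_contra h
        linarith [hx (C 0), hf1 x h]
      have h2 : x ≠ C k := h1 ▸ (hCk k hk).symm
      linarith [hx' (C k), hf'1 x h2, hf2 x]
    have hg1 := (hA _ (h𝓜 f hf)).2
    have hg2 := (hA _ (h𝓜 f' hf')).2
    simp only [PGS, gaussianModel_objective] at hg1 hg2
    exact A.le_lintegral_visits (measurable_shiftDensity f (C k) (-(4 * ε)) σ)
      -- The reflected model raises `C k` by `4ε`; it need not belong to the class.
      (measurable_shiftDensity f (C k) (- -(4 * ε)) σ)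
      (gaussianModel_update_outputLaw f (C k) _ hσ) (gaussianModel_update_outputLaw f (C k) _ hσ)
      (by have : (0 : ℝ) < σ := by exact_mod_cast hσ
          have : (-(4 * ε)) ≠ 0 := by linarith
          positivity)
      (shiftDensity_mul_shiftDensity_neg f (C k) _ σ) hdisj hδ hδ' hg1 hg2
  have hinj : Set.InjOn C (Finset.Icc 1 d : Finset ℕ) := hCinj.mono fun k hk => by
    rw [Finset.coe_Icc] at hk
    exact hk.2
  calc ENNReal.ofReal (1 / 128 * (d * (σ : ℝ) ^ 2 / ε ^ 2 * Real.log (1 / δ)))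
      = ∑ k ∈ Finset.Icc 1 d, ENNReal.ofReal (Real.log (1 / δ) /
          (8 * ((-(4 * ε)) ^ 2 / (σ : ℝ) ^ 2))) := by
        -- The constant is `8 · 4² = 128`, with `d` equal summands.
        rw [Finset.sum_const, Nat.card_Icc, Nat.add_sub_cancel, nsmul_eq_mul,
          ← ENNReal.ofReal_natCast, ← ENNReal.ofReal_mul (by positivity)]
        congr 1
        have : (σ : ℝ) ≠ 0 := by exact_mod_cast hσ.ne'
        field_simp
        ring
    _ ≤ ∑ k ∈ Finset.Icc 1 d,
          ∫⁻ ω, A.stopped (A.visits (C k)) ω ∂A.runLaw (gaussianModel f σ) :=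
        Finset.sum_le_sum harm
    _ = ∑ x ∈ (Finset.Icc 1 d).image C,
          ∫⁻ ω, A.stopped (A.visits x) ω ∂A.runLaw (gaussianModel f σ) :=
        (Finset.sum_image (f := fun x =>
          ∫⁻ ω, A.stopped (A.visits x) ω ∂A.runLaw (gaussianModel f σ)) hinj).symm
    _ ≤ A.expectedCost (gaussianModel f σ) := A.sum_lintegral_visits_le _ _

theorem mainTheorem3 :
    ∃ c δ₀ : ℝ, 0 < c ∧ 0 < δ₀ ∧
      ∀ N d : ℕ, 2 ≤ N → 1 ≤ d →
        ∀ σ : ℝ≥0, 0 < σ → ∀ ε δ : ℝ, 0 < ε → 0 < δ → δ ≤ δ₀ →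
          ENNReal.ofReal (c * (d * (σ : ℝ) ^ 2 / ε ^ 2 * Real.log (1 / δ))) ≤
              simulationCost (PGS ε δ) (gaussianConvexModels N d σ) ∧
          ENNReal.ofReal (c * (d * (σ : ℝ) ^ 2 / ε ^ 2 * Real.log (1 / δ))) ≤
              simulationCost (PGS ε δ) (convexModels N d σ) := by
  refine ⟨1 / 128, 1 / 1000, by norm_num, by norm_num, ?_⟩
  intro N d hN _ σ hσ ε δ hε hδ hδ'
  exact ⟨le_expectedCost_of_gaussianModel hN hσ hε hδ hδ' fun f hf =>
      gaussianModel_mem_gaussianConvexModels hf σ,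
    le_expectedCost_of_gaussianModel hN hσ hε hδ hδ' fun f hf =>
      gaussianModel_mem_convexModels hf σ⟩
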